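/- Let $K$ be a field of characteristic zero, let $L_2$ be the free Lie algebra over $K$ on generators $x=x_1$, $y=x_2$, and let $F_2=L_2/L_2''$, where $L_2''=[[L_2,L_2],[L_2,L_2]]$, be the free metabelian Lie algebra of rank $2$. Let $F_2'=[F_2,F_2]$ be its commutator ideal. Let the symmetric group $S_2$ act on $F_2$ by Lie algebra automorphisms permuting $x,y$. Write $F_2^{S_2}$ for the Lie subalgebra of elements fixed by this action (the symmetric polynomials) and $(F_2')^{S_2}=F_2'\cap F_2^{S_2}$. For $a,b\in K$ with $c=a^2-b^2\neq 0$, let $\xi(a,b)$ be the linear automorphism of $F_2$ given by $$\xi(x)=ax+by,\qquad \xi(y)=bx+ay,$$ whose inverse is $$\xi^{-1}(x)=c^{-1}ax-c^{-1}by,\qquad \xi^{-1}(y)=-c^{-1}bx+c^{-1}ay.$$ For $u\in F_2'$ let $\psi_u=\exp(\mathrm{ad}\,u)=1+\mathrm{ad}\,u$ be the inner automorphism $\psi_u(v)=v+[v,u]$ of $F_2$. Let $\varphi$ be an automorphism of the Lie algebra $F_2$ that preserves $F_2^{S_2}$, i.e. $\varphi(v)\in F_2^{S_2}$ for every $v\in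 F_2^{S_2}$. Then there are $a,b\in K$ with $a^2-b^2\neq 0$ and $u\in (F_2')^{S_2}$ such that $$\varphi=\xi(a,b)\circ\psi_u .$$ -/

import Mathlib

/-- The free metabelian Lie algebra `F_n = L_n / L_n''` of rank `n` over `K`, where `L_n` is the
free Lie algebra on `n` generators and `L_n'' = [[L_n, L_n], [L_n, L_n]]`. -/
abbrev FreeMetabelian (K : Type*) [Field K] (n : ℕ) : Type _ :=
  FreeLieAlgebra K (Fin n) ⧸ LieAlgebra.derivedSeries K (FreeLieAlgebra K (Fin n)) 2

namespace FreeMetabelian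

variable (K : Type*) [Field K] {n : ℕ}

/-- The canonical projection `L_n → F_n`. -/
noncomputable def proj (n : ℕ) : FreeLieAlgebra K (Fin n) →ₗ⁅K⁆ FreeMetabelian K n where
  toLinearMap :=
    (LieAlgebra.derivedSeries K (FreeLieAlgebra K (Fin n)) 2).toSubmodule.mkQ
  map_lie' := rfl

theorem proj_surjective (n : ℕ) : Function.Surjective (proj K n) :=
  Submodule.mkQ_surjective _

/-- The free generators `x_1, …, x_n` of `F_n`, indexed by `Fin n`. -/
noncomputable def gen (i : Fin n) : FreeMetabelian K n := proj K n (FreeLieAlgebra.of K i)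

/-- The commutator ideal `F_n' = [F_n, F_n]`. -/
noncomputable abbrev commutatorIdeal (n : ℕ) : LieIdeal K (FreeMetabelian K n) :=
  ⁅(⊤ : LieIdeal K (FreeMetabelian K n)), (⊤ : LieIdeal K (FreeMetabelian K n))⁆

theorem lie_mem_commutatorIdeal (v w : FreeMetabelian K n) : ⁅v, w⁆ ∈ commutatorIdeal K n :=
  LieSubmodule.lie_mem_lie (LieSubmodule.mem_top v) (LieSubmodule.mem_top w)

theorem derivedSeries_two_eq_bot (n : ℕ) :
    LieAlgebra.derivedSeries K (FreeMetabelian K n) 2 = ⊥ := by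
  rw [← LieIdeal.derivedSeries_map_eq (f := proj K n) 2 (proj_surjective K n),
    LieIdeal.map_eq_bot_iff]
  intro x hx
  rw [LieHom.mem_ker]
  exact (LieSubmodule.Quotient.mk_eq_zero' (N := LieAlgebra.derivedSeries K _ 2)).2 hx

theorem lie_eq_zero_of_mem {v w : FreeMetabelian K n}
    (hv : v ∈ commutatorIdeal K n) (hw : w ∈ commutatorIdeal K n) : ⁅v, w⁆ = 0 := by
  have h : ⁅v, w⁆ ∈ LieAlgebra.derivedSeries K (FreeMetabelian K n) 2 :=
    LieSubmodule.lie_mem_lie (I := commutatorIdeal K n) (N := commutatorIdeal K n) hv hw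
  rw [derivedSeries_two_eq_bot] at h
  simpa using h

/-- The endomorphism of `F_n` that sends `x_i` to `f i`. -/
noncomputable def endo (f : Fin n → FreeMetabelian K n) : FreeMetabelian K n →ₗ⁅K⁆ FreeMetabelian K n where
  toLinearMap :=
    (LieAlgebra.derivedSeries K (FreeLieAlgebra K (Fin n)) 2).toSubmodule.liftQ
      (FreeLieAlgebra.lift K f : FreeLieAlgebra K (Fin n) →ₗ[K] FreeMetabelian K n) (by
        intro x hx
        have h := LieIdeal.derivedSeries_map_le (f := FreeLieAlgebra.lift K f) 2
          (LieIdeal.mem_map (f := FreeLieAlgebra.lift K f) hx)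
        rw [derivedSeries_two_eq_bot] at h
        simpa using h)
  map_lie' := by
    intro x y
    obtain ⟨x, rfl⟩ := proj_surjective K n x
    obtain ⟨y, rfl⟩ := proj_surjective K n y
    exact (FreeLieAlgebra.lift K f).map_lie x y

@[simp]
theorem endo_gen (f : Fin n → FreeMetabelian K n) (i : Fin n) : endo K f (gen K i) = f i :=
  FreeLieAlgebra.lift_of_apply f i

theorem hom_ext {g h : FreeMetabelian K n →ₗ⁅K⁆ FreeMetabelian K n}
    (H : ∀ i, g (gen K i) = h (gen K i)) : g = h := by
  have e : g.comp (proj K n) = h.comp (proj K n) := FreeLieAlgebra.hom_ext H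
  ext x
  obtain ⟨x, rfl⟩ := proj_surjective K n x
  exact LieHom.congr_fun e x

/-- The action of a permutation `π ∈ S_n` on `F_n`: `x_i ↦ x_{π(i)}`. -/
noncomputable def perm (π : Equiv.Perm (Fin n)) : FreeMetabelian K n →ₗ⁅K⁆ FreeMetabelian K n :=
  endo K fun i => gen K (π i)

/-- The algebra `F_n^{S_n}` of symmetric polynomials in `F_n`. -/
noncomputable def symmetric (n : ℕ) : LieSubalgebra K (FreeMetabelian K n) where
  carrier := {s | ∀ π : Equiv.Perm (Fin n), perm K π s = s}
  add_mem' := fun {s t} hs ht π => by rw [map_add, hs π, ht π]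
  zero_mem' := fun π => map_zero _
  smul_mem' := fun c s hs π => by rw [map_smul, hs π]
  lie_mem' := fun {s t} hs ht π => by rw [LieHom.map_lie, hs π, ht π]

/-- For `u ∈ F_n'` the inner automorphism `ψ_u = exp (ad u) = 1 + ad u` of `F_n`, where
`ad u : v ↦ [v, u]` has square zero. -/
noncomputable def inner (u : FreeMetabelian K n) (hu : u ∈ commutatorIdeal K n) :
    FreeMetabelian K n ≃ₗ⁅K⁆ FreeMetabelian K n where
  toFun v := v + ⁅v, u⁆
  map_add' v w := by rw [add_lie]; abel
  map_smul' c v := by rw [smul_lie, smul_add, RingHom.id_apply]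
  map_lie' := by
    intro v w
    change ⁅v, w⁆ + ⁅⁅v, w⁆, u⁆ = ⁅v + ⁅v, u⁆, w + ⁅w, u⁆⁆
    have h : ⁅⁅v, u⁆, ⁅w, u⁆⁆ = 0 :=
      lie_eq_zero_of_mem K (lie_mem_commutatorIdeal K v u) (lie_mem_commutatorIdeal K w u)
    rw [add_lie, lie_add, lie_add, h, lie_lie v w u, ← lie_skew w ⁅v, u⁆]
    abel
  invFun v := v - ⁅v, u⁆
  left_inv v := by
    have h : ⁅⁅v, u⁆, u⁆ = 0 := lie_eq_zero_of_mem K (lie_mem_commutatorIdeal K v u) hu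
    change v + ⁅v, u⁆ - ⁅v + ⁅v, u⁆, u⁆ = v
    rw [add_lie, h]; abel
  right_inv v := by
    have h : ⁅⁅v, u⁆, u⁆ = 0 := lie_eq_zero_of_mem K (lie_mem_commutatorIdeal K v u) hu
    change v - ⁅v, u⁆ + ⁅v - ⁅v, u⁆, u⁆ = v
    rw [sub_lie, h]; abel

/-- The endomorphism `x ↦ a x + b y`, `y ↦ b x + a y` of `F_2`, with `x = x_1` and `y = x_2`. -/
noncomputable def xiHom (a b : K) : FreeMetabelian K 2 →ₗ⁅K⁆ FreeMetabelian K 2 :=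
  endo K ![a • gen K 0 + b • gen K 1, b • gen K 0 + a • gen K 1]

theorem xiHom_comp (a b a' b' : K) (h₁ : a * a' + b * b' = 1) (h₂ : a * b' + b * a' = 0)
    (v : FreeMetabelian K 2) : xiHom K a b (xiHom K a' b' v) = v := by
  have e : (xiHom K a b).comp (xiHom K a' b') = LieHom.id := by
    refine hom_ext K fun i => ?_
    have hx : xiHom K a b (gen K 0) = a • gen K 0 + b • gen K 1 := endo_gen K _ 0
    have hy : xiHom K a b (gen K 1) = b • gen K 0 + a • gen K 1 := endo_gen K _ 1
    have hx' : xiHom K a' b' (gen K 0) = a' • gen K 0 + b' • gen K 1 := endo_gen K _ 0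
    have hy' : xiHom K a' b' (gen K 1) = b' • gen K 0 + a' • gen K 1 := endo_gen K _ 1
    fin_cases i
    · change xiHom K a b (xiHom K a' b' (gen K 0)) = gen K 0
      rw [hx', map_add, map_smul, map_smul, hx, hy]
      calc _ = (a * a' + b * b') • gen K (0 : Fin 2) + (a * b' + b * a') • gen K (1 : Fin 2) := by
            module
        _ = gen K 0 := by rw [h₁, h₂, one_smul, zero_smul, add_zero]
    · change xiHom K a b (xiHom K a' b' (gen K 1)) = gen K 1
      rw [hy', map_add, map_smul, map_smul, hx, hy]
      calc _ = (a * b' + b * a') • gen K (0 : Fin 2) + (a * a' + b * b') • gen K (1 : Fin 2) := by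
            module
        _ = gen K 1 := by rw [h₁, h₂, one_smul, zero_smul, zero_add]
  exact LieHom.congr_fun e v

/-- The linear automorphism `ξ(a, b)` of `F_2`: with `c = a² - b² ≠ 0`,
`ξ(x) = a x + b y`, `ξ(y) = b x + a y` and
`ξ⁻¹(x) = c⁻¹ a x - c⁻¹ b y`, `ξ⁻¹(y) = - c⁻¹ b x + c⁻¹ a y`. -/
noncomputable def xi (a b : K) (h : a ^ 2 - b ^ 2 ≠ 0) : FreeMetabelian K 2 ≃ₗ⁅K⁆ FreeMetabelian K 2 where
  toLieHom := xiHom K a b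
  invFun := xiHom K ((a ^ 2 - b ^ 2)⁻¹ * a) (-((a ^ 2 - b ^ 2)⁻¹ * b))
  left_inv v := xiHom_comp K _ _ _ _ (by field_simp; ring) (by ring) v
  right_inv v := xiHom_comp K _ _ _ _ (by field_simp; ring) (by ring) v

theorem xi_gen_zero (a b : K) (h : a ^ 2 - b ^ 2 ≠ 0) :
    xi K a b h (gen K 0) = a • gen K 0 + b • gen K 1 := endo_gen K _ 0

theorem xi_gen_one (a b : K) (h : a ^ 2 - b ^ 2 ≠ 0) :
    xi K a b h (gen K 1) = b • gen K 0 + a • gen K 1 := endo_gen K _ 1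

theorem xi_symm_gen_zero (a b : K) (h : a ^ 2 - b ^ 2 ≠ 0) :
    (xi K a b h).symm (gen K 0) =
      ((a ^ 2 - b ^ 2)⁻¹ * a) • gen K 0 + (-((a ^ 2 - b ^ 2)⁻¹ * b)) • gen K 1 := endo_gen K _ 0

theorem xi_symm_gen_one (a b : K) (h : a ^ 2 - b ^ 2 ≠ 0) :
    (xi K a b h).symm (gen K 1) =
      (-((a ^ 2 - b ^ 2)⁻¹ * b)) • gen K 0 + ((a ^ 2 - b ^ 2)⁻¹ * a) • gen K 1 := endo_gen K _ 1

end FreeMetabelian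

/-! Through `ad`, the commutator ideal of `F_2` is a free module of rank one over `K[X 0, X 1]`,
generated by `[x, y]`. Every element therefore has a unique `normalForm`, with uniqueness seen in
triangular matrices (`normalForm_inj`). A homomorphism acts on this module by a linear substitution
followed by multiplication by a Jacobian (`map_polyLie`). For an automorphism the Jacobian is a
unit, hence constant, which ties the nonlinear parts of the two images together (`jacobian_eq`).
Swapping `x` and `y` negates `[x, y]`, so symmetric elements of the ideal correspond to
antisymmetric polynomials. Testing `φ` on `x + y` and on `(X 0 - X 1)[x, y]` makes its linear part
some `ξ(a, b)`. Then `ξ⁻¹ ∘ φ` is trivial modulo commutators, and the Jacobian relation makes it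
inner. Its value at `x + y` shows that the element defining it is symmetric. -/

/-! ### Triangular matrices as a metabelian target. -/

/-- The Lie algebra of upper triangular matrices `!![a, m; 0, 0]` over a commutative ring `A`,
written as pairs `(a, m)`. -/
@[ext]
structure AffineLie (A : Type*) where
  /-- The diagonal entry. -/
  fst : A
  /-- The off-diagonal entry. -/
  snd : A

namespace AffineLie

variable {A : Type*} [CommRing A]

/-- The underlying pair of entries. -/
def equivProd : AffineLie A ≃ A × A where
  toFun u := (u.fst, u.snd)
  invFun p := ⟨p.1, p.2⟩

instance : AddCommGroup (AffineLie A) := equivProd.addCommGroup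

@[simp] theorem fst_add (u v : AffineLie A) : (u + v).fst = u.fst + v.fst := rfl
@[simp] theorem snd_add (u v : AffineLie A) : (u + v).snd = u.snd + v.snd := rfl
@[simp] theorem fst_zero : (0 : AffineLie A).fst = 0 := rfl
@[simp] theorem snd_zero : (0 : AffineLie A).snd = 0 := rfl

instance : Bracket (AffineLie A) (AffineLie A) :=
  ⟨fun u v => ⟨0, u.fst * v.snd - v.fst * u.snd⟩⟩

@[simp] theorem fst_lie (u v : AffineLie A) : ⁅u, v⁆.fst = 0 := rfl
@[simp] theorem snd_lie (u v : AffineLie A) : ⁅u, v⁆.snd = u.fst * v.snd - v.fst * u.snd := rfl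

instance : LieRing (AffineLie A) where
  add_lie u v w := by ext <;> simp; ring
  lie_add u v w := by ext <;> simp; ring
  lie_self u := by ext <;> simp
  leibniz_lie u v w := by ext <;> simp; ring

variable (K : Type*) [CommRing K] [Algebra K A]

instance : Module K (AffineLie A) := equivProd.module K

@[simp] theorem fst_smul (c : K) (u : AffineLie A) : (c • u).fst = c • u.fst := rfl
@[simp] theorem snd_smul (c : K) (u : AffineLie A) : (c • u).snd = c • u.snd := rfl

instance : LieAlgebra K (AffineLie A) where
  lie_smul c u v := by ext <;> simp [smul_sub]

/-- The abelian ideal of strictly upper triangular matrices. -/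
def strictIdeal : LieIdeal K (AffineLie A) where
  carrier := {u | u.fst = 0}
  add_mem' {u v} hu hv := by
    change u.fst + v.fst = 0
    rw [show u.fst = 0 from hu, show v.fst = 0 from hv, add_zero]
  zero_mem' := rfl
  smul_mem' c u hu := by
    change c • u.fst = 0
    rw [show u.fst = 0 from hu, smul_zero]
  lie_mem _ := rfl

theorem derivedSeries_two_eq_bot : LieAlgebra.derivedSeries K (AffineLie A) 2 = ⊥ := by
  have h1 : LieAlgebra.derivedSeries K (AffineLie A) 1 ≤ strictIdeal K := by
    change ⁅(⊤ : LieIdeal K (AffineLie A)), (⊤ : LieIdeal K (AffineLie A))⁆ ≤ _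
    rw [LieSubmodule.lie_le_iff]
    exact fun _ _ _ _ => rfl
  rw [eq_bot_iff]
  change ⁅LieAlgebra.derivedSeries K (AffineLie A) 1, LieAlgebra.derivedSeries K (AffineLie A) 1⁆ ≤ _
  rw [LieSubmodule.lie_le_iff]
  intro u hu v hv
  have hu' : u.fst = 0 := h1 hu
  have hv' : v.fst = 0 := h1 hv
  rw [LieSubmodule.mem_bot]
  ext <;> simp [hu', hv']

end AffineLie

namespace FreeMetabelian

variable (K : Type*) [Field K] {n : ℕ}

/-- The homomorphism from `F_n` to a metabelian algebra of triangular matrices that sends `x_i` to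
`f i`. -/
noncomputable def liftAffine {A : Type*} [CommRing A] [Algebra K A] (f : Fin n → AffineLie A) :
    FreeMetabelian K n →ₗ⁅K⁆ AffineLie A where
  toLinearMap :=
    (LieAlgebra.derivedSeries K (FreeLieAlgebra K (Fin n)) 2).toSubmodule.liftQ
      (FreeLieAlgebra.lift K f : FreeLieAlgebra K (Fin n) →ₗ[K] AffineLie A) (by
        intro x hx
        have h := LieIdeal.derivedSeries_map_le (f := FreeLieAlgebra.lift K f) 2
          (LieIdeal.mem_map (f := FreeLieAlgebra.lift K f) hx)
        rw [AffineLie.derivedSeries_two_eq_bot] at h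
        simpa using h)
  map_lie' := by
    intro x y
    obtain ⟨x, rfl⟩ := proj_surjective K n x
    obtain ⟨y, rfl⟩ := proj_surjective K n y
    exact (FreeLieAlgebra.lift K f).map_lie x y

@[simp]
theorem liftAffine_gen {A : Type*} [CommRing A] [Algebra K A] (f : Fin n → AffineLie A)
    (i : Fin n) : liftAffine K f (gen K i) = f i :=
  FreeLieAlgebra.lift_of_apply f i

/-- A Lie subalgebra containing the generators is the whole algebra. -/
theorem mem_of_gen_mem (S : LieSubalgebra K (FreeMetabelian K n)) (hS : ∀ i, gen K i ∈ S)
    (v : FreeMetabelian K n) : v ∈ S := by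
  have e : S.incl.comp (FreeLieAlgebra.lift K fun i => (⟨gen K i, hS i⟩ : S)) = proj K n := by
    refine FreeLieAlgebra.hom_ext fun i => ?_
    simp [gen]
  obtain ⟨v, rfl⟩ := proj_surjective K n v
  rw [← e]
  exact (FreeLieAlgebra.lift K (fun i => (⟨gen K i, hS i⟩ : S)) v).2

/-- The Jacobi discrepancy is a bracket of two commutators. This is what lets commuting variables
act on the ideal. -/
theorem lie_lie_comm (v w : FreeMetabelian K n) {z : FreeMetabelian K n}
    (hz : z ∈ commutatorIdeal K n) : ⁅v, ⁅w, z⁆⁆ = ⁅w, ⁅v, z⁆⁆ := by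
  rw [leibniz_lie v w z, lie_eq_zero_of_mem K (lie_mem_commutatorIdeal K v w) hz, zero_add]

/-! ### The commutator ideal as a polynomial module. -/

open MvPolynomial

/-- The map `f ↦ f(ad x, ad y) [x, y]` onto the commutator ideal of `F_2`. -/
noncomputable def polyLie : MvPolynomial (Fin 2) K →ₗ[K] FreeMetabelian K 2 :=
  (basisMonomials (Fin 2) K).constr K fun s =>
    ((LieAlgebra.ad K (FreeMetabelian K 2) (gen K 0)) ^ s 0)
      (((LieAlgebra.ad K (FreeMetabelian K 2) (gen K 1)) ^ s 1) ⁅(gen K 0 : FreeMetabelian K 2), gen K 1⁆)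

theorem polyLie_monomial (s : Fin 2 →₀ ℕ) :
    polyLie K (monomial s 1) =
    ((LieAlgebra.ad K (FreeMetabelian K 2) (gen K 0)) ^ s 0)
      (((LieAlgebra.ad K (FreeMetabelian K 2) (gen K 1)) ^ s 1) ⁅(gen K 0 : FreeMetabelian K 2), gen K 1⁆) := by
  exact (congrArg (polyLie K) (congrFun (coe_basisMonomials (Fin 2) K) s).symm).trans
    (Module.Basis.constr_basis _ K _ s)

theorem polyLie_one : polyLie K 1 = ⁅(gen K 0 : FreeMetabelian K 2), gen K 1⁆ := by
  simpa using polyLie_monomial K 0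

theorem ad_pow_mem (v : FreeMetabelian K n) (k : ℕ) {z : FreeMetabelian K n}
    (hz : z ∈ commutatorIdeal K n) :
    ((LieAlgebra.ad K (FreeMetabelian K n) v) ^ k) z ∈ commutatorIdeal K n := by
  cases k with
  | zero => simpa using hz
  | succ k => rw [pow_succ']; exact lie_mem_commutatorIdeal K _ _

theorem lie_ad_pow (v w : FreeMetabelian K n) (k : ℕ) {z : FreeMetabelian K n}
    (hz : z ∈ commutatorIdeal K n) :
    ⁅w, ((LieAlgebra.ad K (FreeMetabelian K n) v) ^ k) z⁆ =
      ((LieAlgebra.ad K (FreeMetabelian K n) v) ^ k) ⁅w, z⁆ := by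
  induction k with
  | zero => rfl
  | succ k ih =>
    rw [pow_succ', Module.End.mul_apply, Module.End.mul_apply, ← ih, LieAlgebra.ad_apply,
      LieAlgebra.ad_apply, lie_lie_comm K w v (ad_pow_mem K v k hz)]

theorem lie_gen_polyLie (i : Fin 2) (f : MvPolynomial (Fin 2) K) :
    ⁅gen K i, polyLie K f⁆ = polyLie K (X i * f) := by
  have e : (LieAlgebra.ad K (FreeMetabelian K 2) (gen K i)).comp (polyLie K) =
      (polyLie K).comp (LinearMap.mulLeft K (X i)) := by
    refine (basisMonomials (Fin 2) K).ext fun s => ?_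
    have h0 := lie_mem_commutatorIdeal K (gen K (0 : Fin 2)) (gen K 1)
    rw [coe_basisMonomials, LinearMap.comp_apply, LinearMap.comp_apply, LinearMap.mulLeft_apply,
      X, monomial_mul, one_mul, polyLie_monomial, polyLie_monomial, LieAlgebra.ad_apply]
    fin_cases i
    · simp [add_comm 1, pow_succ']
    · simp [lie_ad_pow K _ _ _ (ad_pow_mem K (gen K (1 : Fin 2)) (s 1) h0), add_comm 1, pow_succ']
  exact LinearMap.congr_fun e f

theorem polyLie_mem (f : MvPolynomial (Fin 2) K) : polyLie K f ∈ commutatorIdeal K 2 := by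
  induction f using MvPolynomial.induction_on with
  | C c =>
    rw [← mul_one (C c), ← smul_eq_C_mul, map_smul, polyLie_one]
    exact (commutatorIdeal K 2).smul_mem c (lie_mem_commutatorIdeal K _ _)
  | add f g hf hg => rw [map_add]; exact add_mem hf hg
  | mul_X f i _ => rw [mul_comm, ← lie_gen_polyLie]; exact lie_mem_commutatorIdeal K _ _

/-- The element `a x + b y + f(ad x, ad y) [x, y]` of `F_2`. -/
noncomputable def normalForm (a b : K) (f : MvPolynomial (Fin 2) K) : FreeMetabelian K 2 :=
  a • gen K 0 + b • gen K 1 + polyLie K f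

theorem polyLie_lie_polyLie (f g : MvPolynomial (Fin 2) K) : ⁅polyLie K f, polyLie K g⁆ = 0 :=
  lie_eq_zero_of_mem K (polyLie_mem K f) (polyLie_mem K g)

theorem normalForm_lie_polyLie (a b : K) (f g : MvPolynomial (Fin 2) K) :
    ⁅normalForm K a b f, polyLie K g⁆ = polyLie K ((C a * X 0 + C b * X 1) * g) := by
  rw [normalForm, add_lie, add_lie, smul_lie, smul_lie, lie_gen_polyLie, lie_gen_polyLie,
    polyLie_lie_polyLie, add_zero, ← map_smul, ← map_smul, ← map_add, smul_eq_C_mul, smul_eq_C_mul]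
  congr 1; ring

theorem normalForm_lie (a b c d : K) (f g : MvPolynomial (Fin 2) K) :
    ⁅normalForm K a b f, normalForm K c d g⁆ =
      polyLie K (C (a * d - b * c) + (C a * X 0 + C b * X 1) * g - (C c * X 0 + C d * X 1) * f) := by
  have h : normalForm K c d g = c • gen K 0 + d • gen K 1 + polyLie K g := rfl
  have h1 : ⁅normalForm K a b f, c • gen K 0 + d • gen K 1⁆ =
      polyLie K (C (a * d - b * c) - (C c * X 0 + C d * X 1) * f) := by
    have h2 : c • gen K 0 + d • gen K 1 = normalForm K c d 0 := by simp [normalForm]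
    have h3 := normalForm_lie_polyLie K c d 0 f
    have h4 : C (a * d - b * c) = (a * d - b * c) • (1 : MvPolynomial (Fin 2) K) := by
      rw [smul_eq_C_mul, mul_one]
    rw [normalForm, add_lie, map_sub, ← h3, ← h2, ← lie_skew (polyLie K f), h4, map_smul,
      polyLie_one, sub_eq_add_neg]
    congr 1
    simp only [add_lie, lie_add, smul_lie, lie_smul, lie_self, ← lie_skew (gen K (1 : Fin 2)) (gen K 0)]
    module
  rw [h, lie_add, h1, normalForm_lie_polyLie, ← map_add]
  congr 1; ring

theorem exists_normalForm (v : FreeMetabelian K 2) : ∃ a b f, v = normalForm K a b f := by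
  let S : LieSubalgebra K (FreeMetabelian K 2) :=
    { carrier := {v | ∃ a b f, v = normalForm K a b f}
      add_mem' := by
        rintro _ _ ⟨a, b, f, rfl⟩ ⟨c, d, g, rfl⟩
        refine ⟨a + c, b + d, f + g, ?_⟩
        simp only [normalForm, map_add]
        module
      zero_mem' := ⟨0, 0, 0, by simp [normalForm]⟩
      smul_mem' := by
        rintro k _ ⟨a, b, f, rfl⟩
        refine ⟨k * a, k * b, k • f, ?_⟩
        simp only [normalForm, map_smul]
        module
      lie_mem' := by
        rintro _ _ ⟨a, b, f, rfl⟩ ⟨c, d, g, rfl⟩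
        exact ⟨0, 0, _, (normalForm_lie K a b c d f g).trans
          (by rw [normalForm, zero_smul, zero_smul, zero_add, zero_add])⟩ }
  refine mem_of_gen_mem K S (fun i => ?_) v
  fin_cases i
  · exact ⟨1, 0, 0, by simp [normalForm]⟩
  · exact ⟨0, 1, 0, by simp [normalForm]⟩

/-! ### Freeness and uniqueness of the normal form. -/

/-- A faithful representation of `F_2` by triangular matrices. -/
noncomputable def rep : FreeMetabelian K 2 →ₗ⁅K⁆ AffineLie (MvPolynomial (Fin 2) K) :=
  liftAffine K ![⟨X 0, 0⟩, ⟨X 1, 1⟩]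

/-- The generators' images bracket to `⟨0, X 0⟩`, and each then multiplies the second entry by its
variable. The factor `X 0` is harmless, being cancellable. -/
theorem rep_polyLie (f : MvPolynomial (Fin 2) K) : rep K (polyLie K f) = ⟨0, X 0 * f⟩ := by
  induction f using MvPolynomial.induction_on with
  | C c =>
    rw [← mul_one (C c), ← smul_eq_C_mul, map_smul, polyLie_one, map_smul, LieHom.map_lie]
    ext1 <;> simp [rep]
  | add f g hf hg => rw [map_add, map_add, hf, hg]; ext1 <;> simp [mul_add]
  | mul_X f i hf =>
    rw [mul_comm f, ← lie_gen_polyLie, LieHom.map_lie, hf]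
    fin_cases i
    · ext1 <;> simp [rep]
    · ext1 <;> simp [rep]; ring

theorem rep_normalForm (a b : K) (f : MvPolynomial (Fin 2) K) :
    rep K (normalForm K a b f) = ⟨C a * X 0 + C b * X 1, C b + X 0 * f⟩ := by
  rw [normalForm, map_add, rep_polyLie, map_add, map_smul, map_smul]
  ext1 <;> simp [rep, smul_eq_C_mul]

theorem linear_inj {a b c d : K}
    (h : (C a * X 0 + C b * X 1 : MvPolynomial (Fin 2) K) = C c * X 0 + C d * X 1) :
    a = c ∧ b = d := by
  constructor
  · simpa using congrArg (eval ![1, 0]) h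
  · simpa using congrArg (eval ![0, 1]) h

theorem normalForm_inj {a b c d : K} {f g : MvPolynomial (Fin 2) K} :
    normalForm K a b f = normalForm K c d g ↔ a = c ∧ b = d ∧ f = g := by
  refine ⟨fun h => ?_, by rintro ⟨rfl, rfl, rfl⟩; rfl⟩
  have h := congrArg (rep K) h
  rw [rep_normalForm, rep_normalForm, AffineLie.mk.injEq] at h
  obtain ⟨h1, h2⟩ := h
  obtain ⟨rfl, rfl⟩ := linear_inj K h1
  exact ⟨rfl, rfl, mul_left_cancel₀ (X_ne_zero 0) (add_left_cancel h2)⟩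

theorem polyLie_injective : Function.Injective (polyLie K) := by
  intro f g h
  exact ((normalForm_inj K (a := 0) (b := 0) (c := 0) (d := 0)).1 (by simp [normalForm, h])).2.2

/-- The diagonal entry of `rep` vanishes on brackets but records the linear part of a normal form.
-/
theorem exists_polyLie {u : FreeMetabelian K 2} (hu : u ∈ commutatorIdeal K 2) :
    ∃ f, u = polyLie K f := by
  have h : commutatorIdeal K 2 ≤ (AffineLie.strictIdeal K).comap (rep K) := by
    rw [LieSubmodule.lie_le_iff]
    intro v _ w _
    rw [LieIdeal.mem_comap, LieHom.map_lie]
    rfl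
  obtain ⟨a, b, f, rfl⟩ := exists_normalForm K u
  have h1 : (rep K (normalForm K a b f)).fst = 0 := h hu
  rw [rep_normalForm] at h1
  obtain ⟨rfl, rfl⟩ := linear_inj K (c := 0) (d := 0) (h1.trans (by simp))
  exact ⟨f, by simp [normalForm]⟩

theorem gen_zero_eq : gen K (0 : Fin 2) = normalForm K 1 0 0 := by simp [normalForm]

theorem gen_one_eq : gen K (1 : Fin 2) = normalForm K 0 1 0 := by simp [normalForm]

/-! ### Homomorphisms and their Jacobian. -/

/-- The substitution `x ↦ a x + b y`, `y ↦ c x + d y` of polynomials. -/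
noncomputable def linSubst (a b c d : K) : MvPolynomial (Fin 2) K →ₐ[K] MvPolynomial (Fin 2) K :=
  aeval ![C a * X 0 + C b * X 1, C c * X 0 + C d * X 1]

-- The last factor is the coefficient of `[φ x, φ y]`. On the commutator ideal, `ad (φ x)` and `ad
-- (φ y)` see only the linear parts.
variable {K} in
theorem map_polyLie {φ : FreeMetabelian K 2 →ₗ⁅K⁆ FreeMetabelian K 2} {a b c d : K}
    {p q : MvPolynomial (Fin 2) K} (hx : φ (gen K 0) = normalForm K a b p)
    (hy : φ (gen K 1) = normalForm K c d q) (f : MvPolynomial (Fin 2) K) :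
    φ (polyLie K f) = polyLie K (linSubst K a b c d f *
      (C (a * d - b * c) + (C a * X 0 + C b * X 1) * q - (C c * X 0 + C d * X 1) * p)) := by
  induction f using MvPolynomial.induction_on with
  | C k =>
    rw [← mul_one (C k), ← smul_eq_C_mul, map_smul, polyLie_one, map_smul, LieHom.map_lie, hx, hy,
      normalForm_lie, map_smul, map_one, smul_mul_assoc, one_mul, map_smul]
  | add f g hf hg => rw [map_add, map_add, hf, hg, map_add (linSubst K a b c d), add_mul (linSubst K a b c d f), map_add]
  | mul_X f i hf =>
    rw [mul_comm f, ← lie_gen_polyLie, LieHom.map_lie, hf, map_mul (linSubst K a b c d), mul_assoc (linSubst K a b c d _)]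
    fin_cases i
    · simp [hx, normalForm_lie_polyLie, linSubst]
    · simp [hy, normalForm_lie_polyLie, linSubst]

variable {K} in
/-- The Jacobian of an automorphism of `F_2` is a nonzero constant. -/
theorem jacobian_eq {φ : FreeMetabelian K 2 ≃ₗ⁅K⁆ FreeMetabelian K 2} {a b c d : K}
    {p q : MvPolynomial (Fin 2) K} (hx : φ (gen K 0) = normalForm K a b p)
    (hy : φ (gen K 1) = normalForm K c d q) :
    a * d - b * c ≠ 0 ∧ (C a * X 0 + C b * X 1) * q = (C c * X 0 + C d * X 1) * p := by
  -- The preimage of `[x, y]` exhibits an inverse of the Jacobian.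
  obtain ⟨f, hf⟩ := exists_polyLie K
    (lie_mem_commutatorIdeal K (φ.symm (gen K 0)) (φ.symm (gen K 1)))
  have h1 := map_polyLie (φ := φ.toLieHom) hx hy f
  rw [← hf] at h1
  have h2 : φ ⁅φ.symm (gen K 0), φ.symm (gen K 1)⁆ = polyLie K 1 := by
    rw [LieEquiv.map_lie, LieEquiv.apply_symm_apply, LieEquiv.apply_symm_apply, polyLie_one]
  have h3 := polyLie_injective K (h2.symm.trans h1)
  have hu := IsUnit.of_mul_eq_one_right _ h3.symm
  obtain ⟨k, hk, hk'⟩ := MvPolynomial.isUnit_iff_eq_C_of_isReduced.1 hu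
  have h4 : a * d - b * c = k := by simpa using congrArg (eval 0) hk'
  rw [h4] at hk'
  exact ⟨h4 ▸ hk.ne_zero, by linear_combination hk'⟩

/-! ### Symmetric elements in normal form. -/

theorem mem_symmetric_iff {v : FreeMetabelian K 2} :
    v ∈ symmetric K 2 ↔ perm K (Equiv.swap 0 1) v = v := by
  refine ⟨fun h => h _, fun h π => ?_⟩
  obtain rfl | rfl : π = 1 ∨ π = Equiv.swap 0 1 := by revert π; decide
  · have e : perm K (1 : Equiv.Perm (Fin 2)) = LieHom.id :=
      hom_ext K fun i => by simp [perm]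
    rw [e]; rfl
  · exact h

theorem perm_swap_gen_zero : perm K (Equiv.swap (0 : Fin 2) 1) (gen K 0) = gen K 1 := by
  simp [perm]

theorem perm_swap_gen_one : perm K (Equiv.swap (0 : Fin 2) 1) (gen K 1) = gen K 0 := by
  simp [perm]

theorem perm_swap_polyLie (f : MvPolynomial (Fin 2) K) :
    perm K (Equiv.swap (0 : Fin 2) 1) (polyLie K f) = polyLie K (-linSubst K 0 1 1 0 f) := by
  rw [map_polyLie ((perm_swap_gen_zero K).trans (gen_one_eq K))
    ((perm_swap_gen_one K).trans (gen_zero_eq K))]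
  simp

theorem perm_swap_normalForm (a b : K) (f : MvPolynomial (Fin 2) K) :
    perm K (Equiv.swap (0 : Fin 2) 1) (normalForm K a b f) =
      normalForm K b a (-linSubst K 0 1 1 0 f) := by
  rw [normalForm, map_add, map_add, map_smul, map_smul, perm_swap_polyLie, perm_swap_gen_zero,
    perm_swap_gen_one, normalForm, add_comm (a • _)]

theorem normalForm_mem_symmetric {a b : K} {f : MvPolynomial (Fin 2) K} :
    normalForm K a b f ∈ symmetric K 2 ↔ a = b ∧ linSubst K 0 1 1 0 f = -f := by
  rw [mem_symmetric_iff, perm_swap_normalForm, normalForm_inj, neg_eq_iff_eq_neg]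
  tauto

theorem polyLie_mem_symmetric {f : MvPolynomial (Fin 2) K} :
    polyLie K f ∈ symmetric K 2 ↔ linSubst K 0 1 1 0 f = -f := by
  have h := normalForm_mem_symmetric K (a := 0) (b := 0) (f := f)
  simpa [normalForm] using h

theorem gen_add_gen_mem_symmetric : gen K 0 + gen K 1 ∈ symmetric K 2 := by
  rw [mem_symmetric_iff, map_add, perm_swap_gen_zero, perm_swap_gen_one, add_comm]

/-! ### Factoring the automorphism. -/

variable {K}

/-- The linear part of an automorphism preserving the symmetric polynomials commutes with the
transposition of the variables. -/
theorem linear_part_of_preserves_symmetric [CharZero K]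
    {φ : FreeMetabelian K 2 ≃ₗ⁅K⁆ FreeMetabelian K 2}
    (hφ : ∀ v ∈ symmetric K 2, φ v ∈ symmetric K 2) {a b c d : K}
    {p q : MvPolynomial (Fin 2) K} (hx : φ (gen K 0) = normalForm K a b p)
    (hy : φ (gen K 1) = normalForm K c d q) : c = b ∧ d = a := by
  obtain ⟨hdet, hJ⟩ := jacobian_eq hx hy
  have h1 : a + c = b + d := by
    have h := hφ _ (gen_add_gen_mem_symmetric K)
    have e : φ (gen K 0 + gen K 1) = normalForm K (a + c) (b + d) (p + q) := by
      rw [map_add, hx, hy]; simp only [normalForm, map_add]; module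
    rw [e, normalForm_mem_symmetric] at h
    exact h.1
  have h2 : a - c = d - b := by
    have h := hφ (polyLie K (X 0 - X 1)) ((polyLie_mem_symmetric K).2 (by simp [linSubst]))
    have e : φ (polyLie K (X 0 - X 1)) = _ := map_polyLie (φ := φ.toLieHom) hx hy (X 0 - X 1)
    rw [e, add_sub_assoc, hJ, sub_self, add_zero, polyLie_mem_symmetric] at h
    -- Evaluation at `(1, 0)` extracts the coefficient of `X 0`.
    have h3 := congrArg (eval ![1, 0]) h
    simp [linSubst] at h3
    have h4 : (b - d - (c - a)) * (a * d - b * c) = 0 := by linear_combination h3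
    rcases mul_eq_zero.1 h4 with h5 | h5
    · linear_combination h5
    · exact absurd h5 hdet
  have h3 : (2 : K) * (d - a) = 0 := by linear_combination -h1 - h2
  have h4 : d = a := by simpa [sub_eq_zero] using h3
  exact ⟨by linear_combination h1 + h4, h4⟩

/-- An automorphism of `F_2` acting trivially modulo the commutator ideal is inner. -/
theorem exists_inner_of_trivial_mod_commutator {φ : FreeMetabelian K 2 ≃ₗ⁅K⁆ FreeMetabelian K 2}
    {p q : MvPolynomial (Fin 2) K} (hx : φ (gen K 0) = normalForm K 1 0 p)
    (hy : φ (gen K 1) = normalForm K 0 1 q) :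
    ∃ w, ∀ v, φ v = inner K (polyLie K w) (polyLie_mem K w) v := by
  obtain ⟨-, hJ⟩ := jacobian_eq hx hy
  simp only [map_one, map_zero, one_mul, zero_mul, add_zero, zero_add] at hJ
  have hd : (X 0 : MvPolynomial (Fin 2) K) ∣ p := by
    have h1 : (X 0 : MvPolynomial (Fin 2) K) ∣ X 1 * p := ⟨q, hJ.symm⟩
    -- The prime `X 0` divides `X 1 * p` but not `X 1`.
    refine ((X_prime).dvd_or_dvd h1).resolve_left ?_
    rw [X_dvd_X]
    simp
  obtain ⟨w, rfl⟩ := hd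
  have hq : q = X 1 * w := mul_left_cancel₀ (X_ne_zero 0) (hJ.trans (by ring))
  refine ⟨w, fun v => ?_⟩
  have e : φ.toLieHom = (inner K (polyLie K w) (polyLie_mem K w)).toLieHom := by
    refine hom_ext K fun i => ?_
    fin_cases i
    · change φ (gen K 0) = gen K 0 + ⁅gen K 0, polyLie K w⁆
      rw [hx, lie_gen_polyLie]; simp [normalForm]
    · change φ (gen K 1) = gen K 1 + ⁅gen K 1, polyLie K w⁆
      rw [hy, lie_gen_polyLie, hq]; simp [normalForm]
  exact LieHom.congr_fun e v

/-- The commutator part of the image is `(X 0 + X 1) * w`. Its factor `X 0 + X 1` is swap-invariant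
and nonzero, so antisymmetry passes to `w`. -/
theorem polyLie_mem_symmetric_of_inner {w : MvPolynomial (Fin 2) K}
    (h : inner K (polyLie K w) (polyLie_mem K w) (gen K 0 + gen K 1) ∈ symmetric K 2) :
    polyLie K w ∈ symmetric K 2 := by
  have e : inner K (polyLie K w) (polyLie_mem K w) (gen K 0 + gen K 1) =
      normalForm K 1 1 ((X 0 + X 1) * w) := by
    change gen K 0 + gen K 1 + ⁅gen K 0 + gen K 1, polyLie K w⁆ = _
    rw [add_lie, lie_gen_polyLie, lie_gen_polyLie, ← map_add, ← add_mul]; simp [normalForm]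
  rw [e, normalForm_mem_symmetric] at h
  rw [polyLie_mem_symmetric]
  have hne : (X 0 + X 1 : MvPolynomial (Fin 2) K) ≠ 0 := fun h0 => by
    simpa using congrArg (eval ![1, 0]) h0
  refine mul_left_cancel₀ hne ?_
  have h2 := h.2
  rw [map_mul] at h2
  have h3 : linSubst K 0 1 1 0 (X 0 + X 1) = X 0 + X 1 := by simp [linSubst, add_comm]
  rw [h3] at h2
  rw [h2, mul_neg]

/-- The inverse of `ξ(a, b)` has the same shape, hence commutes with the swap. -/
theorem xi_symm_mem_symmetric {a b : K} (h : a ^ 2 - b ^ 2 ≠ 0) {v : FreeMetabelian K 2}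
    (hv : v ∈ symmetric K 2) : (xi K a b h).symm v ∈ symmetric K 2 := by
  rw [mem_symmetric_iff] at hv ⊢
  have e : (perm K (Equiv.swap (0 : Fin 2) 1)).comp (xi K a b h).symm.toLieHom =
      (xi K a b h).symm.toLieHom.comp (perm K (Equiv.swap (0 : Fin 2) 1)) := by
    refine hom_ext K fun i => ?_
    fin_cases i
    · change perm K _ ((xi K a b h).symm (gen K 0)) = (xi K a b h).symm (perm K _ (gen K 0))
      rw [perm_swap_gen_zero, xi_symm_gen_zero, xi_symm_gen_one, map_add, map_smul, map_smul,
        perm_swap_gen_zero, perm_swap_gen_one, add_comm]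
    · change perm K _ ((xi K a b h).symm (gen K 1)) = (xi K a b h).symm (perm K _ (gen K 1))
      rw [perm_swap_gen_one, xi_symm_gen_zero, xi_symm_gen_one, map_add, map_smul, map_smul,
        perm_swap_gen_zero, perm_swap_gen_one, add_comm]
  exact (LieHom.congr_fun e v).trans (congrArg (xi K a b h).symm hv)

end FreeMetabelian

open FreeMetabelian in
theorem mainTheorem4 {K : Type*} [Field K] [CharZero K]
    (φ : FreeMetabelian K 2 ≃ₗ⁅K⁆ FreeMetabelian K 2)
    (hφ : ∀ v ∈ FreeMetabelian.symmetric K 2, φ v ∈ FreeMetabelian.symmetric K 2) :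
    ∃ (a b : K) (hab : a ^ 2 - b ^ 2 ≠ 0)
      (u : FreeMetabelian K 2) (hu : u ∈ FreeMetabelian.commutatorIdeal K 2),
      u ∈ FreeMetabelian.symmetric K 2 ∧
        ∀ v : FreeMetabelian K 2,
          φ v = FreeMetabelian.xi K a b hab (FreeMetabelian.inner K u hu v) := by
  obtain ⟨a, b, p, hx⟩ := exists_normalForm K (φ (gen K 0))
  obtain ⟨c, d, q, hy⟩ := exists_normalForm K (φ (gen K 1))
  obtain ⟨rfl, rfl⟩ := linear_part_of_preserves_symmetric hφ hx hy
  have hab : d ^ 2 - c ^ 2 ≠ 0 := by simpa [sq] using (jacobian_eq hx hy).1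
  have hxi : ∀ f, ∃ g, (xi K d c hab).symm (polyLie K f) = polyLie K g := fun f =>
    ⟨_, map_polyLie (φ := (xi K d c hab).symm.toLieHom)
      ((xi_symm_gen_zero K d c hab).trans (add_zero _).symm |>.trans (by rw [normalForm, map_zero]))
      ((xi_symm_gen_one K d c hab).trans (add_zero _).symm |>.trans (by rw [normalForm, map_zero])) f⟩
  obtain ⟨p', hp⟩ := hxi p
  obtain ⟨q', hq⟩ := hxi q
  -- Since `trans` applies `φ` first, this map is `ξ⁻¹ ∘ φ`, which leaves the inner factor on the
  -- right.
  have hx' : (φ.trans (xi K d c hab).symm) (gen K 0) = normalForm K 1 0 p' := by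
    rw [LieEquiv.trans_apply, hx, normalForm, map_add, hp, ← xi_gen_zero K d c hab,
      LieEquiv.symm_apply_apply, gen_zero_eq]
    simp [normalForm]
  have hy' : (φ.trans (xi K d c hab).symm) (gen K 1) = normalForm K 0 1 q' := by
    rw [LieEquiv.trans_apply, hy, normalForm, map_add, hq, ← xi_gen_one K d c hab,
      LieEquiv.symm_apply_apply, gen_one_eq]
    simp [normalForm]
  obtain ⟨w, hw⟩ := exists_inner_of_trivial_mod_commutator hx' hy'
  refine ⟨d, c, hab, polyLie K w, polyLie_mem K w, polyLie_mem_symmetric_of_inner ?_, fun v => ?_⟩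
  · rw [← hw]
    exact xi_symm_mem_symmetric hab (hφ _ (gen_add_gen_mem_symmetric K))
  · rw [← hw, LieEquiv.trans_apply, LieEquiv.apply_symm_apply]
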